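/- Let $m,n$ be non-negative integers, write $[m]=\{1,\dots,m\}$, and let $c_j\ge 0$ ($j\in[n]$) and $d_{ij}\ge 0$ ($i\in[m]$, $j\in[n]$) be real numbers. A maximum over the empty set is read as $0$. Let $\chi$ be the set of all $[x,y]$ with $x\in\mathbb{R}^{m\times n}$, $y\in\mathbb{R}^n$ such that $$\sum_{i=1}^m x_{ij}\le c_jy_j\ \ \forall j\in[n],\qquad \sum_{j=1}^n x_{ij}\le\max_{j\in[n]}d_{ij}y_j\ \ \forall i\in[m],\qquad x_{ij}\ge 0,\ y_j\in\{0,1\}\ \ \forall i\in[m],\ j\in[n].$$ A linear inequality is *valid* for $\mathrm{conv}(\chi)$ if every point of $\mathrm{conv}(\chi)$ satisfies it; it *defines a facet* of $\mathrm{conv}(\chi)$ if it is valid and the set of points of $\mathrm{conv}(\chi)$ that satisfy it with equality is nonempty and has dimension $\dim\mathrm{conv}(\chi)-1$. Then the following hold. (a) For all $I\subseteq[m]$, $J\subseteq[n]$ and $j'\in[n]\setminus J$, the inequality $$\sum_{i\in I}\sum_{j\in J\cup\{j'\}}x_{ij}-\Big(\sum_{i\in I}\max_{j\in[n]}d_{ij}-\sum_{j\in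 J}c_j\Big)y_{j'}\le\sum_{j\in J}c_j$$ is valid for $\mathrm{conv}(\chi)$. (b) For all $I\subseteq[m]$ and $J\subseteq[n]$ with $\sum_{j\in J}c_j\le\sum_{i\in I}\max_{j\in J}d_{ij}$, the inequality $$\sum_{i\in I}\sum_{j\in[n]}x_{ij}-\sum_{j'\in[n]\setminus J}\Big(\sum_{i\in I}\max_{j\in J\cup\{j'\}}d_{ij}-\sum_{j\in J}c_j\Big)y_{j'}\le\sum_{j\in J}c_j$$ is valid for $\mathrm{conv}(\chi)$. (c) Let $I\subseteq[m]$ and $J\subseteq[n]$ satisfy $$\sum_{j\in J}c_j>\sum_{i\in I}\max_{j\in J}d_{ij},\qquad \max_{j\in[n]}d_{ij}=\max_{j\in J}d_{ij}\ \ \forall i\in I,\qquad \sum_{j\in J\setminus\{j_0\}}c_j<\sum_{i\in I}\max_{j\in J\setminus\{j_0\}}d_{ij}\ \ \forall j_0\in J.$$ Then the inequality $$\sum_{i\in I}\sum_{j\in J}x_{ij}+\sum_{j\in J}\Big(\sum_{j'\in J\setminus\{j\}}c_{j'}-\sum_{i\in I}\max_{j'\in J}d_{ij'}\Big)y_j\le(|J|-1)\Big(\sum_{j\in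 J}c_j-\sum_{i\in I}\max_{j'\in J}d_{ij'}\Big)$$ defines a facet of $\mathrm{conv}(\chi)$. -/

import Mathlib

namespace ServiceCenter

/-- The maximum of `f` over the finite index set `J`, with the convention that the maximum over
the empty set is `0` (no demand is attracted when no center is open). -/
noncomputable def maxOver {ι : Type*} (J : Finset ι) (f : ι → ℝ) : ℝ :=
  if h : J.Nonempty then J.sup' h f else 0

/-- The space of pairs `[x, y]` with `x` an `m × n` array and `y` an `n`-vector. -/
abbrev Point (m n : ℕ) : Type := (Fin m → Fin n → ℝ) × (Fin n → ℝ)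

/-- The mixed-binary set `χ` for capacities `c` and attracted demands `d`. -/
def chi {m n : ℕ} (c : Fin n → ℝ) (d : Fin m → Fin n → ℝ) : Set (Point m n) :=
  {p | (∀ j, ∑ i, p.1 i j ≤ c j * p.2 j) ∧
       (∀ i, ∑ j, p.1 i j ≤ maxOver Finset.univ (fun j => d i j * p.2 j)) ∧
       (∀ i j, 0 ≤ p.1 i j) ∧
       (∀ j, p.2 j = 0 ∨ p.2 j = 1)}

/-- The inequality `f p ≤ b` is valid for the set `P`. -/
def IsValidIneq {E : Type*} (P : Set E) (f : E → ℝ) (b : ℝ) : Prop :=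
  ∀ p ∈ P, f p ≤ b

/-- The dimension of a set: that of the linear space parallel to its affine hull. -/
noncomputable def affDim {E : Type*} [AddCommGroup E] [Module ℝ E] (S : Set E) : ℕ :=
  Module.finrank ℝ (vectorSpan ℝ S)

/-- The linear inequality `f p ≤ b` defines a facet of `P`: it is valid for `P`, and the face
`P ∩ {f = b}` is nonempty and has dimension `dim P - 1`. -/
def DefinesFacet {E : Type*} [AddCommGroup E] [Module ℝ E]
    (P : Set E) (f : E → ℝ) (b : ℝ) : Prop :=
  IsLinearMap ℝ f ∧ IsValidIneq P f b ∧ {p ∈ P | f p = b}.Nonempty ∧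
    affDim {p ∈ P | f p = b} + 1 = affDim P

end ServiceCenter

namespace ServiceCenter

/-! ### Maxima with value `0` on the empty set. -/

section MaxOver

variable {ι : Type*}

/-! Validity only has to be checked on χ, where every y is binary. There the flow is bounded both by
the open capacity and by the attracted demand; each inequality follows by choosing the right bound
according to which centers are open.

For the facet, write C for the capacity of J and D for the demand of I attracted by J. Two families
of points lie on the face. With all of J open, capacity exceeds demand: a proportional flow
saturates every customer of I and leaves slack at every center of positive capacity. With one center
j₀ of J closed, demand exceeds capacity: a proportional flow saturates the rest of J and leaves
slack at every customer with positive remaining demand. Perturbing the first kind exchanges centers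
for a fixed customer (`flowDir_sub_mem_row`); perturbing the second exchanges customers at a fixed
center (`flowDir_sub_mem_col`).

Chaining these exchanges shows that the directions of the face, together with a single flow
direction, span all of χ (`mem_sup`). The origin lies in χ but off the face, so the dimensions
differ by exactly one (`affDim_add_one_eq`). -/

theorem le_maxOver {J : Finset ι} {f : ι → ℝ} {j : ι} (hj : j ∈ J) : f j ≤ maxOver J f := by
  unfold maxOver
  rw [dif_pos ⟨j, hj⟩]
  exact Finset.le_sup' f hj

theorem maxOver_le {J : Finset ι} {f : ι → ℝ} {b : ℝ} (hb : 0 ≤ b) (h : ∀ j ∈ J, f j ≤ b) :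
    maxOver J f ≤ b := by
  unfold maxOver
  split_ifs with hJ
  · exact Finset.sup'_le hJ f h
  · exact hb

theorem maxOver_nonneg {J : Finset ι} {f : ι → ℝ} (h : ∀ j, 0 ≤ f j) : 0 ≤ maxOver J f := by
  by_cases hJ : J.Nonempty
  · obtain ⟨j, hj⟩ := hJ
    exact (h j).trans (le_maxOver hj)
  · simp [maxOver, hJ]

theorem maxOver_mono {J K : Finset ι} {f : ι → ℝ} (h : ∀ j, 0 ≤ f j) (hJK : J ⊆ K) :
    maxOver J f ≤ maxOver K f :=
  maxOver_le (maxOver_nonneg h) fun _ hj => le_maxOver (hJK hj)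

theorem exists_pos_of_maxOver_pos {J : Finset ι} {f : ι → ℝ} (h : 0 < maxOver J f) :
    ∃ j ∈ J, 0 < f j := by
  by_contra! hcon
  exact absurd (maxOver_le le_rfl hcon) (not_le.2 h)

theorem maxOver_pos {J : Finset ι} {f : ι → ℝ} {j : ι} (hj : j ∈ J) (h : 0 < f j) :
    0 < maxOver J f :=
  h.trans_le (le_maxOver hj)

/-- The maximum is attained in J or at a single element of S; in the latter case one increment
covers it, and the others are nonnegative. -/
theorem maxOver_union_le [DecidableEq ι] {J S : Finset ι} {f : ι → ℝ} (h : ∀ j, 0 ≤ f j) :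
    maxOver (J ∪ S) f ≤ maxOver J f + ∑ j ∈ S, (maxOver (insert j J) f - maxOver J f) := by
  have hinc : ∀ j ∈ S, 0 ≤ maxOver (insert j J) f - maxOver J f := fun j _ =>
    sub_nonneg.2 (maxOver_mono h (Finset.subset_insert j J))
  have hsum := Finset.sum_nonneg hinc
  have hJ := maxOver_nonneg (J := J) h
  refine maxOver_le (by linarith) fun j hj => ?_
  rcases Finset.mem_union.1 hj with hj | hj
  · linarith [le_maxOver (f := f) hj]
  · have h1 := Finset.single_le_sum hinc hj
    have h2 := le_maxOver (f := f) (Finset.mem_insert_self j J)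
    linarith

end MaxOver

/-! ### Validity of the three inequalities. -/

section Validity

variable {m n : ℕ} {c : Fin n → ℝ} {d : Fin m → Fin n → ℝ}

theorem isValidIneq_convexHull {E : Type*} [AddCommGroup E] [Module ℝ E] {P : Set E} {f : E → ℝ}
    {b : ℝ} (hf : IsLinearMap ℝ f) (h : ∀ p ∈ P, f p ≤ b) :
    IsValidIneq (convexHull ℝ P) f b := fun _ hp =>
  convexHull_min (t := {q | f q ≤ b}) h (convex_halfSpace_le hf b) hp

theorem sum_flow_le_capacity {p : Point m n} (hp : p ∈ chi c d) (I : Finset (Fin m))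
    (K : Finset (Fin n)) : ∑ i ∈ I, ∑ j ∈ K, p.1 i j ≤ ∑ j ∈ K, c j * p.2 j := by
  obtain ⟨h1, -, h3, -⟩ := hp
  rw [Finset.sum_comm]
  refine Finset.sum_le_sum fun j _ => (Finset.sum_le_univ_sum_of_nonneg fun i => h3 i j).trans (h1 j)

theorem sum_flow_le_demand {p : Point m n} (hp : p ∈ chi c d) (I : Finset (Fin m))
    (K : Finset (Fin n)) :
    ∑ i ∈ I, ∑ j ∈ K, p.1 i j ≤ ∑ i ∈ I, maxOver Finset.univ (fun j => d i j * p.2 j) := by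
  obtain ⟨-, h2, h3, -⟩ := hp
  exact Finset.sum_le_sum fun i _ =>
    (Finset.sum_le_univ_sum_of_nonneg fun j => h3 i j).trans (h2 i)

theorem maxOver_open_le (hd : ∀ i j, 0 ≤ d i j) {y : Fin n → ℝ} (hy : ∀ j, y j = 0 ∨ y j = 1)
    {K : Finset (Fin n)} (hK : ∀ j, y j = 1 → j ∈ K) (i : Fin m) :
    maxOver Finset.univ (fun j => d i j * y j) ≤ maxOver K (d i) := by
  refine maxOver_le (maxOver_nonneg (hd i)) fun j _ => ?_
  rcases hy j with h | h
  · simpa [h] using maxOver_nonneg (hd i)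
  · simpa [h] using le_maxOver (f := d i) (hK j h)

theorem le_maxOver_open (hd : ∀ i j, 0 ≤ d i j) {y : Fin n → ℝ} (hy : ∀ j, y j = 0 ∨ y j = 1)
    {K : Finset (Fin n)} (hK : ∀ j ∈ K, y j = 1) (i : Fin m) :
    maxOver K (d i) ≤ maxOver Finset.univ (fun j => d i j * y j) := by
  refine maxOver_le (maxOver_nonneg fun j => mul_nonneg (hd i j) ?_) fun j hj => ?_
  · rcases hy j with h | h <;> simp [h]
  · have := le_maxOver (f := fun j => d i j * y j) (Finset.mem_univ j)
    simpa [hK j hj] using this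

theorem sum_capacity_open_le (hc : ∀ j, 0 ≤ c j) {y : Fin n → ℝ} (hy : ∀ j, y j = 0 ∨ y j = 1)
    (K : Finset (Fin n)) : ∑ j ∈ K, c j * y j ≤ ∑ j ∈ K, c j := by
  refine Finset.sum_le_sum fun j _ => ?_
  rcases hy j with h | h <;> simp [h, hc j]

/-- If j' is closed, it carries no flow and the capacity of J is the bound. If it is open, the
capacity terms cancel and total demand is the bound. -/
theorem valid_single (hc : ∀ j, 0 ≤ c j) (hd : ∀ i j, 0 ≤ d i j) (I : Finset (Fin m))
    (J : Finset (Fin n)) {j' : Fin n} (hj' : j' ∉ J) :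
    IsValidIneq (convexHull ℝ (chi c d))
      (fun p => ∑ i ∈ I, ∑ j ∈ insert j' J, p.1 i j
        - (∑ i ∈ I, maxOver Finset.univ (d i) - ∑ j ∈ J, c j) * p.2 j')
      (∑ j ∈ J, c j) := by
  refine isValidIneq_convexHull ⟨fun p q => ?_, fun a p => ?_⟩ fun p hp => ?_
  · simp only [Prod.fst_add, Prod.snd_add, Pi.add_apply, Finset.sum_add_distrib]; ring
  · simp only [Prod.smul_fst, Prod.smul_snd, Pi.smul_apply, smul_eq_mul, ← Finset.mul_sum]; ring
  · have hy := hp.2.2.2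
    rcases hy j' with h | h
    · have h1 := sum_flow_le_capacity hp I (insert j' J)
      rw [Finset.sum_insert hj', h] at h1
      have h2 := sum_capacity_open_le hc hy J
      simp only [h]
      linarith
    · have h1 := sum_flow_le_demand hp I (insert j' J)
      have h2 := Finset.sum_le_sum fun i (_ : i ∈ I) =>
        maxOver_open_le hd hy (K := Finset.univ) (fun j _ => Finset.mem_univ j) i
      simp only [h]
      linarith

theorem valid_complement (hc : ∀ j, 0 ≤ c j) (hd : ∀ i j, 0 ≤ d i j) (I : Finset (Fin m))
    (J : Finset (Fin n)) (hJ : ∑ j ∈ J, c j ≤ ∑ i ∈ I, maxOver J (d i)) :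
    IsValidIneq (convexHull ℝ (chi c d))
      (fun p => ∑ i ∈ I, ∑ j, p.1 i j
        - ∑ j' ∈ Finset.univ \ J,
            (∑ i ∈ I, maxOver (insert j' J) (d i) - ∑ j ∈ J, c j) * p.2 j')
      (∑ j ∈ J, c j) := by
  refine isValidIneq_convexHull ⟨fun p q => ?_, fun a p => ?_⟩ fun p hp => ?_
  · simp only [Prod.fst_add, Prod.snd_add, Pi.add_apply, Finset.sum_add_distrib, mul_add]; ring
  · simp only [Prod.smul_fst, Prod.smul_snd, Pi.smul_apply, smul_eq_mul, ← Finset.mul_sum,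
      mul_left_comm _ a]
    ring
  · have hy := hp.2.2.2
    set S := (Finset.univ \ J).filter (fun j => p.2 j = 1) with hS
    have hsum : ∑ j' ∈ Finset.univ \ J,
        (∑ i ∈ I, maxOver (insert j' J) (d i) - ∑ j ∈ J, c j) * p.2 j' =
        ∑ j' ∈ S, (∑ i ∈ I, maxOver (insert j' J) (d i) - ∑ j ∈ J, c j) := by
      rw [hS, Finset.sum_filter]
      refine Finset.sum_congr rfl fun j _ => ?_
      rcases hy j with h | h <;> simp [h]
    simp only [hsum]
    -- S is the set of open centers outside J. If it is empty, capacity of J bounds the flow;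
    -- otherwise demand does.
    rcases S.eq_empty_or_nonempty with hS0 | hS0
    · have h1 := sum_flow_le_capacity hp I Finset.univ
      have h2 : ∑ j, c j * p.2 j = ∑ j ∈ J, c j * p.2 j := by
        refine (Finset.sum_subset (Finset.subset_univ J) fun j _ hj => ?_).symm
        have : p.2 j ≠ 1 := fun h => by
          have : j ∈ S := by simp [hS, hj, h]
          simp [hS0] at this
        simp [(hy j).resolve_right this]
      have h3 := sum_capacity_open_le hc hy J
      rw [hS0]
      simp only [Finset.sum_empty]
      linarith
    · have h1 := sum_flow_le_demand hp I Finset.univ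
      have h2 : ∑ i ∈ I, maxOver Finset.univ (fun j => d i j * p.2 j) ≤
          ∑ i ∈ I, (maxOver J (d i) + ∑ j ∈ S, (maxOver (insert j J) (d i) - maxOver J (d i))) := by
        refine Finset.sum_le_sum fun i _ =>
          (maxOver_open_le hd hy (K := J ∪ S) (fun j h => ?_) i).trans (maxOver_union_le (hd i))
        by_cases hj : j ∈ J <;> simp [hS, hj, h]
      rw [Finset.sum_add_distrib, Finset.sum_comm] at h2
      simp only [Finset.sum_sub_distrib, Finset.sum_const, nsmul_eq_mul] at h2 ⊢
      have h3 : (1 : ℝ) ≤ S.card := by exact_mod_cast hS0.card_pos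
      -- After `maxOver_union_le` the remaining gap is (|S| - 1) times demand minus capacity of J, a
      -- product of nonnegative factors.
      nlinarith [mul_nonneg (sub_nonneg.2 h3) (sub_nonneg.2 hJ)]

/-- The left-hand side of the facet-defining inequality. -/
noncomputable def facetForm (c : Fin n → ℝ) (d : Fin m → Fin n → ℝ) (I : Finset (Fin m))
    (J : Finset (Fin n)) (p : Point m n) : ℝ :=
  ∑ i ∈ I, ∑ j ∈ J, p.1 i j
    + ∑ j ∈ J, (∑ j' ∈ J.erase j, c j' - ∑ i ∈ I, maxOver J (d i)) * p.2 j

/-- The right-hand side of the facet-defining inequality. -/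
noncomputable def facetBound (c : Fin n → ℝ) (d : Fin m → Fin n → ℝ) (I : Finset (Fin m))
    (J : Finset (Fin n)) : ℝ :=
  ((J.card : ℝ) - 1) * (∑ j ∈ J, c j - ∑ i ∈ I, maxOver J (d i))

variable (I : Finset (Fin m)) (J : Finset (Fin n))

theorem isLinearMap_facetForm : IsLinearMap ℝ (facetForm c d I J) := by
  refine ⟨fun p q => ?_, fun a p => ?_⟩ <;> unfold facetForm
  · simp only [Prod.fst_add, Prod.snd_add, Pi.add_apply, Finset.sum_add_distrib, mul_add]; ring
  · simp only [Prod.smul_fst, Prod.smul_snd, Pi.smul_apply, smul_eq_mul, ← Finset.mul_sum,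
      mul_left_comm _ a]
    ring

/-- The coefficient of y_j is C - D - c_j. Hence the form is flow minus open capacity in J, plus C -
D for each open center of J. -/
theorem facetForm_eq (p : Point m n) :
    facetForm c d I J p = ∑ i ∈ I, ∑ j ∈ J, p.1 i j - ∑ j ∈ J, c j * p.2 j
      + (∑ j ∈ J, c j - ∑ i ∈ I, maxOver J (d i)) * ∑ j ∈ J, p.2 j := by
  unfold facetForm
  rw [Finset.mul_sum, sub_add, ← Finset.sum_sub_distrib, sub_eq_add_neg, ← Finset.sum_neg_distrib]
  congr 1
  refine Finset.sum_congr rfl fun j hj => ?_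
  rw [← Finset.add_sum_erase J c hj]
  ring

theorem facetForm_all_open {p : Point m n} (hp : ∀ j ∈ J, p.2 j = 1) :
    facetForm c d I J p = facetBound c d I J
      + (∑ i ∈ I, ∑ j ∈ J, p.1 i j - ∑ i ∈ I, maxOver J (d i)) := by
  have h1 : ∑ j ∈ J, c j * p.2 j = ∑ j ∈ J, c j :=
    Finset.sum_congr rfl fun j hj => by rw [hp j hj, mul_one]
  have h2 : ∑ j ∈ J, p.2 j = J.card := by
    rw [Finset.sum_congr rfl hp]; simp
  rw [facetForm_eq, h1, h2, facetBound]
  ring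

theorem facetForm_one_closed {p : Point m n} {j₀ : Fin n} (hj₀ : j₀ ∈ J) (h0 : p.2 j₀ = 0)
    (hp : ∀ j ∈ J.erase j₀, p.2 j = 1) :
    facetForm c d I J p = facetBound c d I J
      + (∑ i ∈ I, ∑ j ∈ J, p.1 i j - ∑ j ∈ J.erase j₀, c j) := by
  have h1 : ∑ j ∈ J, c j * p.2 j = ∑ j ∈ J.erase j₀, c j := by
    rw [← Finset.add_sum_erase J _ hj₀, h0, mul_zero, zero_add]
    exact Finset.sum_congr rfl fun j hj => by rw [hp j hj, mul_one]
  have h2 : ∑ j ∈ J, p.2 j = (J.card : ℝ) - 1 := by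
    rw [← Finset.add_sum_erase J _ hj₀, h0, zero_add, Finset.sum_congr rfl hp]
    rw [← Finset.card_erase_add_one hj₀]
    simp
  rw [facetForm_eq, h1, h2, facetBound]
  ring

/-- With J fully open, demand bounds the flow, and `hI` keeps centers outside J from raising it.
Otherwise flow minus open capacity is at most 0 and at most |J| - 1 centers of J count, each with
weight C - D > 0. -/
theorem facetForm_le (hd : ∀ i j, 0 ≤ d i j)
    (hJ : ∑ i ∈ I, maxOver J (d i) < ∑ j ∈ J, c j)
    (hI : ∀ i ∈ I, maxOver Finset.univ (d i) = maxOver J (d i))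
    {p : Point m n} (hp : p ∈ chi c d) : facetForm c d I J p ≤ facetBound c d I J := by
  have hy := hp.2.2.2
  by_cases hall : ∀ j ∈ J, p.2 j = 1
  · have h1 := sum_flow_le_demand hp I J
    have h2 : ∑ i ∈ I, maxOver Finset.univ (fun j => d i j * p.2 j) ≤ ∑ i ∈ I, maxOver J (d i) :=
      Finset.sum_le_sum fun i hi =>
        (maxOver_open_le hd hy (fun j _ => Finset.mem_univ j) i).trans (hI i hi).le
    rw [facetForm_all_open I J hall]
    linarith
  · push Not at hall
    obtain ⟨j₀, hj₀, hne⟩ := hall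
    have h1 := sum_flow_le_capacity hp I J
    have h2 : ∑ j ∈ J, p.2 j ≤ (J.card : ℝ) - 1 := by
      rw [← Finset.add_sum_erase J _ hj₀, (hy j₀).resolve_right hne, zero_add,
        ← Finset.card_erase_add_one hj₀]
      have : ∑ j ∈ J.erase j₀, p.2 j ≤ ∑ j ∈ J.erase j₀, (1 : ℝ) :=
        Finset.sum_le_sum fun j _ => by rcases hy j with h | h <;> simp [h]
      simpa using this
    rw [facetForm_eq, facetBound]
    nlinarith [mul_le_mul_of_nonneg_left h2 (sub_pos.2 hJ).le]

end Validity

/-! ### A dimension count for faces. -/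

section Dimension

/-- The point q off the hyperplane makes the inclusion of direction spaces strict, and the vector w
shows that the gap is at most one. -/
theorem affDim_add_one_eq {E : Type*} [AddCommGroup E] [Module ℝ E] [FiniteDimensional ℝ E]
    {S P : Set E} {f : E → ℝ} {b : ℝ} (hf : IsLinearMap ℝ f) (hSP : S ⊆ P) (hS : S.Nonempty)
    (hfS : ∀ p ∈ S, f p = b) {q : E} (hq : q ∈ P) (hfq : f q ≠ b) {w : E}
    (hP : ∀ p ∈ P, p ∈ vectorSpan ℝ S ⊔ Submodule.span ℝ {w}) :
    affDim S + 1 = affDim P := by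
  unfold affDim
  obtain ⟨s, hs⟩ := hS
  apply le_antisymm
  · refine Submodule.finrank_lt_finrank_of_lt (lt_of_le_of_ne (vectorSpan_mono ℝ hSP) ?_)
    intro heq
    have hker : vectorSpan ℝ S ≤ LinearMap.ker (hf.mk' f) := by
      rw [vectorSpan_def, Submodule.span_le]
      rintro _ ⟨x, hx, y, hy, rfl⟩
      simp [hf.map_sub, hfS x hx, hfS y hy]
    have hmem : q -ᵥ s ∈ vectorSpan ℝ S := heq ▸ vsub_mem_vectorSpan ℝ hq (hSP hs)
    have h0 := hker hmem
    simp [hf.map_sub, hfS s hs, sub_eq_zero] at h0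
    exact hfq h0
  · have hle : vectorSpan ℝ P ≤ vectorSpan ℝ S ⊔ Submodule.span ℝ {w} := by
      rw [vectorSpan_def, Submodule.span_le]
      rintro _ ⟨x, hx, y, hy, rfl⟩
      exact Submodule.sub_mem _ (hP x hx) (hP y hy)
    refine (Submodule.finrank_mono hle).trans
      ((Submodule.finrank_add_le_finrank_add_finrank _ _).trans ?_)
    exact Nat.add_le_add_left
      ((finrank_span_le_card (R := ℝ) ({w} : Set E)).trans (by simp)) _

end Dimension

/-! ### Small flow perturbations inside χ. -/

section Perturbation

open Filter Topology

variable {m n : ℕ} {c : Fin n → ℝ} {d : Fin m → Fin n → ℝ}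

theorem eventually_add_mul_le {a b u : ℝ} (ha : a ≤ b) (h : a < b ∨ u ≤ 0) :
    ∀ᶠ ε in 𝓝[>] (0 : ℝ), a + ε * u ≤ b := by
  rcases h with h | h
  · have ht : Tendsto (fun ε : ℝ => a + ε * u) (𝓝[>] 0) (𝓝 (a + 0 * u)) :=
      (Continuous.tendsto (by fun_prop) 0).mono_left nhdsWithin_le_nhds
    rw [zero_mul, add_zero] at ht
    exact (ht.eventually_lt_const h).mono fun _ h => h.le
  · filter_upwards [self_mem_nhdsWithin] with ε hε
    nlinarith [mul_nonneg (le_of_lt (Set.mem_Ioi.1 hε)) (neg_nonneg.2 h)]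

/-- With y fixed, the right-hand sides are constants. Each of the finitely many constraints is
either slack or not worsened by u, so all survive for small ε > 0. -/
theorem exists_perturbation_mem_chi {p : Point m n} (hp : p ∈ chi c d) (u : Fin m → Fin n → ℝ)
    (hcol : ∀ j, ∑ i, p.1 i j < c j * p.2 j ∨ ∑ i, u i j ≤ 0)
    (hrow : ∀ i, ∑ j, p.1 i j < maxOver Finset.univ (fun j => d i j * p.2 j) ∨ ∑ j, u i j ≤ 0)
    (hpos : ∀ i j, 0 < p.1 i j ∨ 0 ≤ u i j) :
    ∃ ε : ℝ, 0 < ε ∧ p + ε • ((u, 0) : Point m n) ∈ chi c d := by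
  obtain ⟨h1, h2, h3, h4⟩ := hp
  have e1 : ∀ᶠ ε in 𝓝[>] (0 : ℝ), ∀ j, ∑ i, p.1 i j + ε * ∑ i, u i j ≤ c j * p.2 j :=
    eventually_all.2 fun j => eventually_add_mul_le (h1 j) (hcol j)
  have e2 : ∀ᶠ ε in 𝓝[>] (0 : ℝ), ∀ i, ∑ j, p.1 i j + ε * ∑ j, u i j ≤
      maxOver Finset.univ (fun j => d i j * p.2 j) :=
    eventually_all.2 fun i => eventually_add_mul_le (h2 i) (hrow i)
  have e3 : ∀ᶠ ε in 𝓝[>] (0 : ℝ), ∀ i j, -p.1 i j + ε * (-u i j) ≤ 0 :=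
    eventually_all.2 fun i => eventually_all.2 fun j =>
      eventually_add_mul_le (neg_nonpos.2 (h3 i j)) ((hpos i j).imp neg_neg_iff_pos.2 neg_nonpos.2)
  obtain ⟨ε, hε, f1, f2, f3⟩ :=
    ((eventually_mem_nhdsWithin (s := Set.Ioi (0 : ℝ))).and (e1.and (e2.and e3))).exists
  refine ⟨ε, hε, fun j => ?_, fun i => ?_, fun i j => ?_, fun j => ?_⟩
  · simpa [Finset.sum_add_distrib, Finset.mul_sum] using f1 j
  · simpa [Finset.sum_add_distrib, Finset.mul_sum] using f2 i
  · have := f3 i j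
    simp
    linarith
  · simpa using h4 j

/-- The face of `conv χ` cut out by the facet-defining inequality. -/
def facetFace (c : Fin n → ℝ) (d : Fin m → Fin n → ℝ) (I : Finset (Fin m))
    (J : Finset (Fin n)) : Set (Point m n) :=
  {p ∈ convexHull ℝ (chi c d) | facetForm c d I J p = facetBound c d I J}

theorem mem_facetFace {I : Finset (Fin m)} {J : Finset (Fin n)} {p : Point m n}
    (hp : p ∈ chi c d) (h : facetForm c d I J p = facetBound c d I J) : p ∈ facetFace c d I J :=
  ⟨subset_convexHull ℝ _ hp, h⟩

theorem mem_vectorSpan_of_perturbation {I : Finset (Fin m)} {J : Finset (Fin n)} {p : Point m n}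
    (hp : p ∈ chi c d) (h : facetForm c d I J p = facetBound c d I J) (u : Fin m → Fin n → ℝ)
    (hu : ∑ i ∈ I, ∑ j ∈ J, u i j = 0)
    (hcol : ∀ j, ∑ i, p.1 i j < c j * p.2 j ∨ ∑ i, u i j ≤ 0)
    (hrow : ∀ i, ∑ j, p.1 i j < maxOver Finset.univ (fun j => d i j * p.2 j) ∨ ∑ j, u i j ≤ 0)
    (hpos : ∀ i j, 0 < p.1 i j ∨ 0 ≤ u i j) :
    ((u, 0) : Point m n) ∈ vectorSpan ℝ (facetFace c d I J) := by
  obtain ⟨ε, hε, hmem⟩ := exists_perturbation_mem_chi hp u hcol hrow hpos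
  have hform : facetForm c d I J (p + ε • ((u, 0) : Point m n)) = facetBound c d I J := by
    rw [(isLinearMap_facetForm I J).map_add, (isLinearMap_facetForm I J).map_smul, h]
    simp [facetForm, hu]
  have := vsub_mem_vectorSpan ℝ (mem_facetFace hmem hform) (mem_facetFace hp h)
  rw [vsub_eq_sub, add_sub_cancel_left] at this
  exact (Submodule.smul_mem_iff _ hε.ne').1 this

end Perturbation

end ServiceCenter

namespace ServiceCenter

/-! ### Coordinate directions. -/

section Basis

variable {m n : ℕ}

/-- The matrix unit at position `(i, j)`. -/
def unitFlow (i : Fin m) (j : Fin n) (a : Fin m) (b : Fin n) : ℝ :=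
  if a = i ∧ b = j then 1 else 0

theorem sum_unitFlow_col (i : Fin m) (j b : Fin n) :
    ∑ a, unitFlow i j a b = if b = j then 1 else 0 := by
  simp [unitFlow, ite_and]

theorem sum_unitFlow_row (i a : Fin m) (j : Fin n) :
    ∑ b, unitFlow i j a b = if a = i then 1 else 0 := by
  simp [unitFlow, ite_and]

theorem unitFlow_nonneg (i a : Fin m) (j b : Fin n) : 0 ≤ unitFlow i j a b := by
  unfold unitFlow; split_ifs <;> norm_num

theorem sum_sum_unitFlow (I : Finset (Fin m)) (J : Finset (Fin n)) (i : Fin m) (j : Fin n) :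
    ∑ a ∈ I, ∑ b ∈ J, unitFlow i j a b = if i ∈ I ∧ j ∈ J then 1 else 0 := by
  simp [unitFlow, ite_and]

/-- The direction that moves a single flow variable. -/
def flowDir (i : Fin m) (j : Fin n) : Point m n := (unitFlow i j, 0)

/-- The direction that moves a single opening variable. -/
def openDir (j : Fin n) : Point m n := (0, Pi.single j 1)

theorem flow_eq_sum (u : Fin m → Fin n → ℝ) :
    ((u, 0) : Point m n) = ∑ i, ∑ j, u i j • flowDir i j := by
  ext a b
  · simp [Prod.fst_sum, flowDir, unitFlow, ite_and]
  · simp [Prod.snd_sum, flowDir]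

theorem point_eq_sum (p : Point m n) :
    p = (p.1, 0) + ∑ j, p.2 j • openDir j := by
  ext a b
  · simp [Prod.fst_sum, openDir]
  · simp [Prod.snd_sum, openDir, Pi.single_apply]

end Basis

/-! ### Proportional flows. -/

section BasePoint

variable {m n : ℕ} {c : Fin n → ℝ} {d : Fin m → Fin n → ℝ}

/-- The point with opening vector `y` whose flow from the customers in `I` to the centers in `K` is
proportional to capacity and demand. -/
noncomputable def basePoint (c : Fin n → ℝ) (d : Fin m → Fin n → ℝ) (I : Finset (Fin m))
    (K : Finset (Fin n)) (T : ℝ) (y : Fin n → ℝ) : Point m n :=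
  (fun i j => if i ∈ I ∧ j ∈ K then c j * maxOver K (d i) / T else 0, y)

variable {I : Finset (Fin m)} {J K : Finset (Fin n)} {T : ℝ} {y : Fin n → ℝ}

theorem sum_basePoint_col (j : Fin n) : ∑ i, (basePoint c d I K T y).1 i j =
    if j ∈ K then c j * (∑ i ∈ I, maxOver K (d i)) / T else 0 := by
  by_cases hj : j ∈ K <;> simp [basePoint, hj, Finset.mul_sum, Finset.sum_div]

theorem sum_basePoint_row (i : Fin m) : ∑ j, (basePoint c d I K T y).1 i j =
    if i ∈ I then maxOver K (d i) * (∑ j ∈ K, c j) / T else 0 := by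
  by_cases hi : i ∈ I <;>
    simp [basePoint, hi, mul_comm (maxOver K (d i)), Finset.sum_mul, Finset.sum_div]

theorem sum_sum_basePoint (hKJ : K ⊆ J) : ∑ i ∈ I, ∑ j ∈ J, (basePoint c d I K T y).1 i j =
    (∑ i ∈ I, maxOver K (d i)) * (∑ j ∈ K, c j) / T := by
  rw [Finset.sum_mul, Finset.sum_div]
  refine Finset.sum_congr rfl fun i hi => ?_
  have h := sum_basePoint_row (c := c) (d := d) (I := I) (K := K) (T := T) (y := y) i
  rw [if_pos hi] at h
  rw [← h]
  refine Finset.sum_subset (Finset.subset_univ J) fun j _ hj => ?_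
  have : j ∉ K := fun h => hj (hKJ h)
  simp [basePoint, this]

/-- T only has to dominate both total capacity and total demand of K. Taking T equal to the capacity
saturates the rows of I; taking T equal to the demand saturates the columns of K. -/
theorem basePoint_mem_chi (hc : ∀ j, 0 ≤ c j) (hd : ∀ i j, 0 ≤ d i j)
    (hy : ∀ j, y j = 0 ∨ y j = 1) (hK : ∀ j ∈ K, y j = 1) (hT : 0 < T)
    (hCT : ∑ j ∈ K, c j ≤ T) (hDT : ∑ i ∈ I, maxOver K (d i) ≤ T) :
    basePoint c d I K T y ∈ chi c d := by
  refine ⟨fun j => ?_, fun i => ?_, fun i j => ?_, hy⟩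
  · rw [sum_basePoint_col]
    split_ifs with hj
    · simp only [basePoint, hK j hj, mul_one]
      rw [div_le_iff₀ hT]
      exact mul_le_mul_of_nonneg_left hDT (hc j)
    · refine mul_nonneg (hc j) ?_
      rcases hy j with h | h <;> simp [basePoint, h]
  · rw [sum_basePoint_row]
    have h := le_maxOver_open hd hy hK i
    have h0 := maxOver_nonneg (J := K) (hd i)
    split_ifs with hi
    · refine le_trans ?_ h
      rw [div_le_iff₀ hT]
      exact mul_le_mul_of_nonneg_left hCT h0
    · exact h0.trans h
  · simp only [basePoint]
    split_ifs
    · exact div_nonneg (mul_nonneg (hc j) (maxOver_nonneg (hd i))) hT.le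
    · exact le_rfl

end BasePoint

/-! ### The facet: spanning directions of the face. -/

section Facet

variable {m n : ℕ} {c : Fin n → ℝ} {d : Fin m → Fin n → ℝ}

/-- The conditions under which the third inequality defines a facet. -/
structure FacetData (c : Fin n → ℝ) (d : Fin m → Fin n → ℝ) (I : Finset (Fin m))
    (J : Finset (Fin n)) : Prop where
  capacity_nonneg : ∀ j, 0 ≤ c j
  demand_nonneg : ∀ i j, 0 ≤ d i j
  demand_lt : ∑ i ∈ I, maxOver J (d i) < ∑ j ∈ J, c j
  max_eq : ∀ i ∈ I, maxOver Finset.univ (d i) = maxOver J (d i)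
  erase_lt : ∀ j₀ ∈ J, ∑ j ∈ J.erase j₀, c j < ∑ i ∈ I, maxOver (J.erase j₀) (d i)

namespace FacetData

variable {I : Finset (Fin m)} {J : Finset (Fin n)} (H : FacetData c d I J)
include H

/-- C > D, D is at least the demand left after deleting j, and that exceeds C - c_j. -/
theorem capacity_pos {j : Fin n} (hj : j ∈ J) : 0 < c j := by
  have h1 := H.demand_lt
  have h2 := H.erase_lt j hj
  have h3 : ∑ i ∈ I, maxOver (J.erase j) (d i) ≤ ∑ i ∈ I, maxOver J (d i) :=
    Finset.sum_le_sum fun i _ => maxOver_mono (H.demand_nonneg i) (Finset.erase_subset j J)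
  have h4 := Finset.add_sum_erase J c hj
  linarith

theorem sum_demand_nonneg (K : Finset (Fin n)) : 0 ≤ ∑ i ∈ I, maxOver K (d i) :=
  Finset.sum_nonneg fun i _ => maxOver_nonneg (H.demand_nonneg i)

theorem total_pos : 0 < ∑ j ∈ J, c j := (H.sum_demand_nonneg J).trans_lt H.demand_lt

theorem erase_pos {j₀ : Fin n} (hj₀ : j₀ ∈ J) : 0 < ∑ i ∈ I, maxOver (J.erase j₀) (d i) :=
  (Finset.sum_nonneg fun j _ => H.capacity_nonneg j).trans_lt (H.erase_lt j₀ hj₀)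

theorem nonempty : J.Nonempty := by
  by_contra h
  rw [Finset.not_nonempty_iff_eq_empty] at h
  simpa [h] using H.total_pos

/-- If J were a singleton, deleting its element would leave demand `0`, contradicting `erase_pos`.
-/
theorem exists_mem_ne {a : Fin n} (ha : a ∈ J) : ∃ j ∈ J, j ≠ a := by
  by_contra! h
  have : J.erase a = ∅ := Finset.eq_empty_of_forall_notMem fun j hj =>
    Finset.ne_of_mem_erase hj (h j (Finset.mem_of_mem_erase hj))
  have h0 := H.erase_pos ha
  simp [this, maxOver] at h0

theorem exists_erase_pos {i : Fin m} (hi : 0 < maxOver J (d i)) :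
    ∃ j₀ ∈ J, 0 < maxOver (J.erase j₀) (d i) := by
  obtain ⟨a, ha, hda⟩ := exists_pos_of_maxOver_pos hi
  obtain ⟨j₀, hj₀, hne⟩ := H.exists_mem_ne ha
  exact ⟨j₀, hj₀, maxOver_pos (Finset.mem_erase.2 ⟨hne.symm, ha⟩) hda⟩

/-- If no customer of I were attracted by both centers, the two single-center demands would sum to
at most D < c a + c b, although each exceeds the capacity of its center. -/
theorem exists_pos_erase_pair {a b : Fin n} (hJ : J = {a, b}) (hab : a ≠ b) :
    ∃ i ∈ I, 0 < maxOver (J.erase a) (d i) ∧ 0 < maxOver (J.erase b) (d i) := by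
  have ha : a ∈ J := by simp [hJ]
  have hb : b ∈ J := by simp [hJ]
  by_contra! hcon
  have hle : ∀ i ∈ I, maxOver (J.erase a) (d i) + maxOver (J.erase b) (d i) ≤ maxOver J (d i) := by
    intro i hi
    have h1 := maxOver_mono (H.demand_nonneg i) (Finset.erase_subset a J)
    have h2 := maxOver_mono (H.demand_nonneg i) (Finset.erase_subset b J)
    have h3 := maxOver_nonneg (J := J.erase a) (H.demand_nonneg i)
    rcases h3.eq_or_lt with h | h
    · linarith
    · linarith [hcon i hi h]
  have hsum := Finset.sum_le_sum hle
  rw [Finset.sum_add_distrib] at hsum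
  have hC : ∑ j ∈ J, c j = c a + c b := by rw [hJ, Finset.sum_pair hab]
  linarith [H.demand_lt, H.erase_lt a ha, H.erase_lt b hb, Finset.add_sum_erase J c ha,
    Finset.add_sum_erase J c hb]

/-- Any two customers with positive demand share a deletion leaving both demands positive, possibly
through an intermediate customer. -/
theorem exists_common_erase {i i' : Fin m} (hi : 0 < maxOver J (d i))
    (hi' : 0 < maxOver J (d i')) :
    (∃ j₀ ∈ J, 0 < maxOver (J.erase j₀) (d i) ∧ 0 < maxOver (J.erase j₀) (d i')) ∨
    ∃ k ∈ I, ∃ j₀ ∈ J, ∃ j₁ ∈ J,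
      (0 < maxOver (J.erase j₀) (d i) ∧ 0 < maxOver (J.erase j₀) (d k)) ∧
      (0 < maxOver (J.erase j₁) (d k) ∧ 0 < maxOver (J.erase j₁) (d i')) := by
  obtain ⟨a, ha, hda⟩ := exists_pos_of_maxOver_pos hi
  obtain ⟨b, hb, hdb⟩ := exists_pos_of_maxOver_pos hi'
  -- Deleting a third center keeps both a and b. Without one, J = {a, b}, and a customer attracted
  -- by both centers serves as the intermediate.
  by_cases h : ∃ j₀ ∈ J, j₀ ≠ a ∧ j₀ ≠ b
  · obtain ⟨j₀, hj₀, h1, h2⟩ := h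
    exact Or.inl ⟨j₀, hj₀, maxOver_pos (Finset.mem_erase.2 ⟨h1.symm, ha⟩) hda,
      maxOver_pos (Finset.mem_erase.2 ⟨h2.symm, hb⟩) hdb⟩
  · push Not at h
    have hab : a ≠ b := by
      rintro rfl
      obtain ⟨j, hj, hne⟩ := H.exists_mem_ne ha
      exact hne (h j hj hne)
    have hJ : J = {a, b} := by
      ext j
      simp only [Finset.mem_insert, Finset.mem_singleton]
      refine ⟨fun hj => or_iff_not_imp_left.2 (h j hj), ?_⟩
      rintro (rfl | rfl) <;> assumption
    obtain ⟨k, hk, h1, h2⟩ := H.exists_pos_erase_pair hJ hab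
    exact Or.inr ⟨k, hk, b, hb, a, ha,
      ⟨maxOver_pos (Finset.mem_erase.2 ⟨hab, ha⟩) hda, h2⟩,
      h1, maxOver_pos (Finset.mem_erase.2 ⟨hab.symm, hb⟩) hdb⟩

/-! The two families of points on the face: all centers of `J` open, or all but one. -/

theorem allOpen_mem {y : Fin n → ℝ} (hy : ∀ j, y j = 0 ∨ y j = 1) (hJ : ∀ j ∈ J, y j = 1) :
    basePoint c d I J (∑ j ∈ J, c j) y ∈ chi c d :=
  basePoint_mem_chi H.capacity_nonneg H.demand_nonneg hy hJ H.total_pos le_rfl H.demand_lt.le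

theorem facetForm_allOpen {y : Fin n → ℝ} (hJ : ∀ j ∈ J, y j = 1) :
    facetForm c d I J (basePoint c d I J (∑ j ∈ J, c j) y) = facetBound c d I J := by
  rw [facetForm_all_open I J hJ, sum_sum_basePoint subset_rfl,
    mul_div_cancel_right₀ _ H.total_pos.ne']
  ring

theorem allOpen_col_lt {y : Fin n → ℝ} {j : Fin n} (hc : 0 < c j) (hj : y j = 1) :
    ∑ i, (basePoint c d I J (∑ j ∈ J, c j) y).1 i j < c j * y j := by
  rw [sum_basePoint_col, hj, mul_one]
  split_ifs
  · rw [div_lt_iff₀ H.total_pos]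
    exact mul_lt_mul_of_pos_left H.demand_lt hc
  · exact hc

/-- The opening vector with only `j₀` closed. -/
def oneClosed (j₀ : Fin n) (j : Fin n) : ℝ := if j = j₀ then 0 else 1

omit H in
theorem oneClosed_binary (j₀ j : Fin n) : oneClosed j₀ j = 0 ∨ oneClosed j₀ j = 1 := by
  unfold oneClosed; split_ifs <;> simp

omit H in
theorem oneClosed_of_ne {j₀ j : Fin n} (h : j ≠ j₀) : oneClosed j₀ j = 1 := if_neg h

/-- The base point with the center `j₀` closed and the other capacities in `J` used up. -/
noncomputable def closedPoint (c : Fin n → ℝ) (d : Fin m → Fin n → ℝ) (I : Finset (Fin m))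
    (J : Finset (Fin n)) (j₀ : Fin n) : Point m n :=
  basePoint c d I (J.erase j₀) (∑ i ∈ I, maxOver (J.erase j₀) (d i)) (oneClosed j₀)

theorem closedPoint_mem {j₀ : Fin n} (hj₀ : j₀ ∈ J) : closedPoint c d I J j₀ ∈ chi c d :=
  basePoint_mem_chi H.capacity_nonneg H.demand_nonneg (oneClosed_binary j₀)
    (fun _ hj => oneClosed_of_ne (Finset.ne_of_mem_erase hj)) (H.erase_pos hj₀)
    (H.erase_lt j₀ hj₀).le le_rfl

theorem facetForm_closedPoint {j₀ : Fin n} (hj₀ : j₀ ∈ J) :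
    facetForm c d I J (closedPoint c d I J j₀) = facetBound c d I J := by
  rw [facetForm_one_closed I J hj₀ (if_pos rfl)
    (fun _ hj => oneClosed_of_ne (Finset.ne_of_mem_erase hj)), closedPoint,
    sum_sum_basePoint (Finset.erase_subset j₀ J), mul_div_cancel_left₀ _ (H.erase_pos hj₀).ne']
  ring

theorem closedPoint_row_lt {j₀ : Fin n} (hj₀ : j₀ ∈ J) {i : Fin m}
    (hi : 0 < maxOver (J.erase j₀) (d i)) :
    ∑ j, (closedPoint c d I J j₀).1 i j <
      maxOver Finset.univ (fun j => d i j * (closedPoint c d I J j₀).2 j) := by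
  refine lt_of_lt_of_le ?_ (le_maxOver_open H.demand_nonneg (oneClosed_binary j₀)
    (K := J.erase j₀) (fun _ hj => oneClosed_of_ne (Finset.ne_of_mem_erase hj)) i)
  rw [closedPoint, sum_basePoint_row]
  split_ifs
  · rw [div_lt_iff₀ (H.erase_pos hj₀)]
    exact mul_lt_mul_of_pos_left (H.erase_lt j₀ hj₀) hi
  · exact hi

/-! Directions contained in the span of the face. -/

theorem flowDir_mem_of_notMem_left {i : Fin m} (hi : i ∉ I) {j j' : Fin n} (hc : 0 < c j)
    (hd : 0 < d i j') : flowDir i j ∈ vectorSpan ℝ (facetFace c d I J) := by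
  refine mem_vectorSpan_of_perturbation
    (H.allOpen_mem (y := fun _ => 1) (fun _ => Or.inr rfl) fun _ _ => rfl)
    (H.facetForm_allOpen fun _ _ => rfl) (unitFlow i j) ?_ (fun b => ?_) (fun a => ?_)
    fun a b => Or.inr (unitFlow_nonneg i a j b)
  · simp [sum_sum_unitFlow, hi]
  · rw [sum_unitFlow_col]
    split_ifs with hb
    · subst hb
      exact Or.inl (H.allOpen_col_lt hc rfl)
    · exact Or.inr le_rfl
  · rw [sum_unitFlow_row]
    split_ifs with ha
    · subst ha
      left
      rw [sum_basePoint_row, if_neg hi]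
      exact maxOver_pos (Finset.mem_univ j') (by simpa [basePoint] using hd)
    · exact Or.inr le_rfl

/-- The flow variable does not occur in the form. With a suitable center of J closed, row i is
slack, and column j is open and unused. -/
theorem flowDir_mem_of_notMem_right {i : Fin m} (hi : 0 < maxOver J (d i)) {j : Fin n}
    (hj : j ∉ J) (hc : 0 < c j) : flowDir i j ∈ vectorSpan ℝ (facetFace c d I J) := by
  obtain ⟨j₀, hj₀, hpos⟩ := H.exists_erase_pos hi
  have hne : j ≠ j₀ := fun h => hj (h ▸ hj₀)
  refine mem_vectorSpan_of_perturbation (H.closedPoint_mem hj₀) (H.facetForm_closedPoint hj₀)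
    (unitFlow i j) ?_ (fun b => ?_) (fun a => ?_) fun a b => Or.inr (unitFlow_nonneg i a j b)
  · simp [sum_sum_unitFlow, hj]
  · rw [sum_unitFlow_col]
    split_ifs with hb
    · subst hb
      left
      rw [closedPoint, sum_basePoint_col, if_neg fun h => hj (Finset.mem_of_mem_erase h)]
      simpa [basePoint, oneClosed_of_ne hne] using hc
    · exact Or.inr le_rfl
  · rw [sum_unitFlow_row]
    split_ifs with ha
    · subst ha
      exact Or.inl (H.closedPoint_row_lt hj₀ hpos)
    · exact Or.inr le_rfl

omit H in
theorem flowDir_sub (i i' : Fin m) (j j' : Fin n) :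
    flowDir i j - flowDir i' j' = (fun a b => unitFlow i j a b - unitFlow i' j' a b, 0) := by
  ext <;> simp [flowDir]

/-- At the all-open point the exchange preserves the saturated row sums, column j has room, and the
entry being decreased is positive. -/
theorem flowDir_sub_mem_row {i : Fin m} (hi : i ∈ I) (hpos : 0 < maxOver J (d i)) {j j' : Fin n}
    (hj : j ∈ J) (hj' : j' ∈ J) :
    flowDir i j - flowDir i j' ∈ vectorSpan ℝ (facetFace c d I J) := by
  rw [flowDir_sub]
  refine mem_vectorSpan_of_perturbation
    (H.allOpen_mem (y := fun _ => 1) (fun _ => Or.inr rfl) fun _ _ => rfl)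
    (H.facetForm_allOpen fun _ _ => rfl) _ ?_ (fun b => ?_) (fun a => Or.inr ?_) fun a b => ?_
  · simp [Finset.sum_sub_distrib, sum_sum_unitFlow, hi, hj, hj']
  · by_cases hb : b = j
    · subst hb
      exact Or.inl (H.allOpen_col_lt (H.capacity_pos hj) rfl)
    · right
      rw [Finset.sum_sub_distrib, sum_unitFlow_col, sum_unitFlow_col, if_neg hb]
      split_ifs <;> norm_num
  · rw [Finset.sum_sub_distrib, sum_unitFlow_row, sum_unitFlow_row, sub_self]
  · by_cases hab : a = i ∧ b = j'
    · left
      simp only [basePoint, hab, hi, hj', and_self, if_true]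
      exact div_pos (mul_pos (H.capacity_pos hj') hpos) H.total_pos
    · right
      have : unitFlow i j' a b = 0 := if_neg hab
      rw [this, sub_zero]
      exact unitFlow_nonneg i a j b

/-- Dual to the row exchange: at the point with j₀ closed, the saturated column sums are preserved
and row i has room. -/
theorem flowDir_sub_mem_col {i i' : Fin m} (hi : i ∈ I) (hi' : i' ∈ I) {j₀ j : Fin n}
    (hj₀ : j₀ ∈ J) (hpos : 0 < maxOver (J.erase j₀) (d i))
    (hpos' : 0 < maxOver (J.erase j₀) (d i')) (hj : j ∈ J.erase j₀) :
    flowDir i j - flowDir i' j ∈ vectorSpan ℝ (facetFace c d I J) := by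
  rw [flowDir_sub]
  refine mem_vectorSpan_of_perturbation (H.closedPoint_mem hj₀) (H.facetForm_closedPoint hj₀)
    _ ?_ (fun b => Or.inr ?_) (fun a => ?_) fun a b => ?_
  · simp [Finset.sum_sub_distrib, sum_sum_unitFlow, hi, hi']
  · rw [Finset.sum_sub_distrib, sum_unitFlow_col, sum_unitFlow_col, sub_self]
  · by_cases ha : a = i
    · subst ha
      exact Or.inl (H.closedPoint_row_lt hj₀ hpos)
    · right
      rw [Finset.sum_sub_distrib, sum_unitFlow_row, sum_unitFlow_row, if_neg ha]
      split_ifs <;> norm_num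
  · by_cases hab : a = i' ∧ b = j
    · left
      simp only [closedPoint, basePoint, hab, hi', hj, and_self, if_true]
      exact div_pos (mul_pos (H.capacity_pos (Finset.mem_of_mem_erase hj)) hpos')
        (H.erase_pos hj₀)
    · right
      have : unitFlow i' j a b = 0 := if_neg hab
      rw [this, sub_zero]
      exact unitFlow_nonneg i a j b

theorem flowDir_sub_mem_of_common {i i' : Fin m} (hi : i ∈ I) (hi' : i' ∈ I) {j₀ : Fin n}
    (hj₀ : j₀ ∈ J) (hpos : 0 < maxOver (J.erase j₀) (d i))
    (hpos' : 0 < maxOver (J.erase j₀) (d i')) {j j' : Fin n} (hj : j ∈ J) (hj' : j' ∈ J) :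
    flowDir i j - flowDir i' j' ∈ vectorSpan ℝ (facetFace c d I J) := by
  obtain ⟨k, hk, -⟩ := exists_pos_of_maxOver_pos hpos
  have hkJ := Finset.mem_of_mem_erase hk
  have hsub := Finset.erase_subset j₀ J
  have h1 := H.flowDir_sub_mem_row hi
    (hpos.trans_le (maxOver_mono (H.demand_nonneg i) hsub)) hj hkJ
  have h2 := H.flowDir_sub_mem_col hi hi' hj₀ hpos hpos' hk
  have h3 := H.flowDir_sub_mem_row hi'
    (hpos'.trans_le (maxOver_mono (H.demand_nonneg i') hsub)) hkJ hj'
  -- The path is (i, j), (i, k), (i', k), (i', j'), with k surviving the deletion of j₀.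
  simpa using add_mem (add_mem h1 h2) h3

theorem flowDir_sub_mem {i i' : Fin m} (hi : i ∈ I) (hi' : i' ∈ I)
    (hpos : 0 < maxOver J (d i)) (hpos' : 0 < maxOver J (d i')) {j j' : Fin n} (hj : j ∈ J)
    (hj' : j' ∈ J) : flowDir i j - flowDir i' j' ∈ vectorSpan ℝ (facetFace c d I J) := by
  rcases H.exists_common_erase hpos hpos' with ⟨j₀, hj₀, h, h'⟩ |
    ⟨k, hk, j₀, hj₀, j₁, hj₁, ⟨h1, h2⟩, h3, h4⟩
  · exact H.flowDir_sub_mem_of_common hi hi' hj₀ h h' hj hj'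
  · simpa using add_mem (H.flowDir_sub_mem_of_common hi hk hj₀ h1 h2 hj hj)
      (H.flowDir_sub_mem_of_common hk hi' hj₁ h3 h4 hj hj')

/-- Opening or closing j outside J leaves both the all-open flow and the form unchanged. -/
theorem openDir_mem_of_notMem {j : Fin n} (hj : j ∉ J) :
    openDir j ∈ vectorSpan ℝ (facetFace c d I J) := by
  have hJ : ∀ k ∈ J, oneClosed j k = 1 := fun k hk => oneClosed_of_ne fun h => hj (h ▸ hk)
  have h := vsub_mem_vectorSpan ℝ
    (mem_facetFace (H.allOpen_mem (y := fun _ => 1) (fun _ => Or.inr rfl) fun _ _ => rfl)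
      (H.facetForm_allOpen fun _ _ => rfl))
    (mem_facetFace (H.allOpen_mem (oneClosed_binary j) hJ) (H.facetForm_allOpen hJ))
  convert h using 1
  ext a b
  · simp [openDir, basePoint]
  · by_cases h : a = j <;> simp [openDir, basePoint, oneClosed, h]

theorem exists_pos_demand : ∃ i ∈ I, 0 < maxOver J (d i) := by
  obtain ⟨j, hj⟩ := H.nonempty
  by_contra! h
  refine absurd (H.erase_pos hj) (not_lt.2 (Finset.sum_nonpos fun i hi => ?_))
  exact (maxOver_mono (H.demand_nonneg i) (Finset.erase_subset j J)).trans (h i hi)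

/-! ### One extra flow direction suffices to span χ. -/

section Span

variable {i₀ : Fin m} {k₀ : Fin n} (hi₀ : i₀ ∈ I) (hpos₀ : 0 < maxOver J (d i₀)) (hk₀ : k₀ ∈ J)
include hi₀ hpos₀ hk₀

theorem flowDir_mem_sup {i : Fin m} {j j' : Fin n} (hc : 0 < c j) (hd : 0 < d i j') :
    flowDir i j ∈ vectorSpan ℝ (facetFace c d I J) ⊔ Submodule.span ℝ {flowDir i₀ k₀} := by
  by_cases hi : i ∈ I
  · have hpos : 0 < maxOver J (d i) := H.max_eq i hi ▸ maxOver_pos (Finset.mem_univ j') hd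
    by_cases hj : j ∈ J
    · have h := add_mem (Submodule.mem_sup_left (H.flowDir_sub_mem hi hi₀ hpos hpos₀ hj hk₀))
        (Submodule.mem_sup_right (Submodule.mem_span_singleton_self (R := ℝ) (flowDir i₀ k₀)))
      simpa using h
    · exact Submodule.mem_sup_left (H.flowDir_mem_of_notMem_right hpos hj hc)
  · exact Submodule.mem_sup_left (H.flowDir_mem_of_notMem_left hi hc hd)

/-- The polytope need not be full-dimensional, so only positive entries are treated: such an entry
forces positive capacity at j and some positive demand of i. -/
theorem flow_mem_sup {p : Point m n} (hp : p ∈ chi c d) :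
    ((p.1, 0) : Point m n) ∈
      vectorSpan ℝ (facetFace c d I J) ⊔ Submodule.span ℝ {flowDir i₀ k₀} := by
  obtain ⟨h1, h2, h3, h4⟩ := hp
  rw [flow_eq_sum]
  refine sum_mem fun i _ => sum_mem fun j _ => ?_
  rcases (h3 i j).eq_or_lt with h | h
  · rw [← h, zero_smul]
    exact zero_mem _
  · have hcol := h.trans_le ((Finset.single_le_sum (f := fun i => p.1 i j)
      (fun a _ => h3 a j) (Finset.mem_univ i)).trans (h1 j))
    have hrow := h.trans_le ((Finset.single_le_sum (f := fun j => p.1 i j)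
      (fun b _ => h3 i b) (Finset.mem_univ j)).trans (h2 i))
    obtain ⟨j', -, hj'⟩ := exists_pos_of_maxOver_pos hrow
    refine Submodule.smul_mem _ _ (H.flowDir_mem_sup hi₀ hpos₀ hk₀ (j' := j') ?_ ?_)
    · rcases h4 j with hy | hy
      · simp [hy] at hcol
      · simpa [hy] using hcol
    · rcases h4 j' with hy | hy
      · simp [hy] at hj'
      · simpa [hy] using hj'

/-- For j in J, the all-open point and the point with j closed differ by this direction plus flows,
which are already in the span. -/
theorem openDir_mem_sup (j : Fin n) : openDir j ∈
    vectorSpan ℝ (facetFace c d I J) ⊔ Submodule.span ℝ {flowDir i₀ k₀} := by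
  by_cases hj : j ∈ J
  · have hp := H.allOpen_mem (y := fun _ => 1) (fun _ => Or.inr rfl) fun _ _ => rfl
    have hq := H.closedPoint_mem hj
    have h := Submodule.mem_sup_left (T := Submodule.span ℝ {flowDir i₀ k₀})
      (vsub_mem_vectorSpan ℝ (mem_facetFace hp (H.facetForm_allOpen fun _ _ => rfl))
        (mem_facetFace hq (H.facetForm_closedPoint hj)))
    have h' := add_mem (sub_mem h (H.flow_mem_sup hi₀ hpos₀ hk₀ hp))
      (H.flow_mem_sup hi₀ hpos₀ hk₀ hq)
    convert h' using 1
    ext a b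
    · simp [openDir]
    · by_cases h : a = j <;> simp [openDir, closedPoint, basePoint, oneClosed, h]
  · exact Submodule.mem_sup_left (H.openDir_mem_of_notMem hj)

theorem mem_sup {p : Point m n} (hp : p ∈ chi c d) :
    p ∈ vectorSpan ℝ (facetFace c d I J) ⊔ Submodule.span ℝ {flowDir i₀ k₀} := by
  rw [point_eq_sum p]
  exact add_mem (H.flow_mem_sup hi₀ hpos₀ hk₀ hp)
    (sum_mem fun j _ => Submodule.smul_mem _ _ (H.openDir_mem_sup hi₀ hpos₀ hk₀ j))

end Span

omit H in
theorem zero_mem_chi : (0 : Point m n) ∈ chi c d := by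
  refine ⟨fun j => by simp, fun i => ?_, fun i j => by simp, fun j => Or.inl rfl⟩
  simpa using maxOver_nonneg (J := Finset.univ) (f := fun _ : Fin n => (0 : ℝ)) fun _ => le_rfl

/-- Both factors are positive because J has at least two elements and C > D. This puts the origin
off the face. -/
theorem facetBound_pos : 0 < facetBound c d I J := by
  obtain ⟨a, ha⟩ := H.nonempty
  obtain ⟨b, hb, hne⟩ := H.exists_mem_ne ha
  have hcard : (1 : ℝ) < J.card := by
    exact_mod_cast Finset.one_lt_card.2 ⟨b, hb, a, ha, hne⟩
  exact mul_pos (sub_pos.2 hcard) (sub_pos.2 H.demand_lt)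

theorem definesFacet :
    DefinesFacet (convexHull ℝ (chi c d)) (facetForm c d I J) (facetBound c d I J) := by
  have hlin := isLinearMap_facetForm (c := c) (d := d) I J
  obtain ⟨i₀, hi₀, hpos₀⟩ := H.exists_pos_demand
  obtain ⟨k₀, hk₀⟩ := H.nonempty
  have hne : (facetFace c d I J).Nonempty :=
    ⟨_, mem_facetFace (H.closedPoint_mem hk₀) (H.facetForm_closedPoint hk₀)⟩
  refine ⟨hlin, isValidIneq_convexHull hlin fun p hp =>
    facetForm_le I J H.demand_nonneg H.demand_lt H.max_eq hp, hne, ?_⟩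
  refine affDim_add_one_eq hlin (Set.sep_subset _ _) hne (fun p hp => hp.2)
    (subset_convexHull ℝ _ zero_mem_chi) (w := flowDir i₀ k₀) ?_ fun p hp => ?_
  · rw [hlin.map_zero]
    exact H.facetBound_pos.ne
  · exact convexHull_min (fun q hq => H.mem_sup hi₀ hpos₀ hk₀ hq) (Submodule.convex _) hp

end FacetData

end Facet

end ServiceCenter

theorem mainTheorem4 (m n : ℕ) (c : Fin n → ℝ) (d : Fin m → Fin n → ℝ)
    (hc : ∀ j, 0 ≤ c j) (hd : ∀ i j, 0 ≤ d i j) :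
    (∀ (I : Finset (Fin m)) (J : Finset (Fin n)) (j' : Fin n), j' ∉ J →
      ServiceCenter.IsValidIneq (convexHull ℝ (ServiceCenter.chi c d))
        (fun p => ∑ i ∈ I, ∑ j ∈ insert j' J, p.1 i j
          - (∑ i ∈ I, ServiceCenter.maxOver Finset.univ (d i) - ∑ j ∈ J, c j) * p.2 j')
        (∑ j ∈ J, c j)) ∧
    (∀ (I : Finset (Fin m)) (J : Finset (Fin n)),
      ∑ j ∈ J, c j ≤ ∑ i ∈ I, ServiceCenter.maxOver J (d i) →
      ServiceCenter.IsValidIneq (convexHull ℝ (ServiceCenter.chi c d))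
        (fun p => ∑ i ∈ I, ∑ j, p.1 i j
          - ∑ j' ∈ Finset.univ \ J,
              (∑ i ∈ I, ServiceCenter.maxOver (insert j' J) (d i) - ∑ j ∈ J, c j) * p.2 j')
        (∑ j ∈ J, c j)) ∧
    (∀ (I : Finset (Fin m)) (J : Finset (Fin n)),
      ∑ i ∈ I, ServiceCenter.maxOver J (d i) < ∑ j ∈ J, c j →
      (∀ i ∈ I, ServiceCenter.maxOver Finset.univ (d i) = ServiceCenter.maxOver J (d i)) →
      (∀ j₀ ∈ J, ∑ j ∈ J.erase j₀, c j < ∑ i ∈ I, ServiceCenter.maxOver (J.erase j₀) (d i)) →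
      ServiceCenter.DefinesFacet (convexHull ℝ (ServiceCenter.chi c d))
        (fun p => ∑ i ∈ I, ∑ j ∈ J, p.1 i j
          + ∑ j ∈ J, (∑ j' ∈ J.erase j, c j' - ∑ i ∈ I, ServiceCenter.maxOver J (d i)) * p.2 j)
        (((J.card : ℝ) - 1) * (∑ j ∈ J, c j - ∑ i ∈ I, ServiceCenter.maxOver J (d i)))) := by
  refine ⟨fun I J j' hj' => ServiceCenter.valid_single hc hd I J hj',
    fun I J hJ => ServiceCenter.valid_complement hc hd I J hJ, fun I J h1 h2 h3 => ?_⟩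
  exact ServiceCenter.FacetData.definesFacet ⟨hc, hd, h1, h2, h3⟩
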